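/- Let $M$ be a smooth finite-dimensional manifold (boundary and corners are allowed; in particular $M$ may be any smooth, compact, oriented 4-manifold), and let $(g,J,\omega)$ be an almost-Kähler structure on $M$. That is, $\omega$ is a symplectic form (a smooth nondegenerate 2-form with $d\omega=0$); $J$ is a smooth almost-complex structure ($J^2=-1$) compatible with $\omega$, i.e. $\omega(Jv,Jw)=\omega(v,w)$ for all tangent vectors $v,w$ at a common point, and $\omega(v,Jv)>0$ for all $v\neq 0$; and $g$ is the associated Riemannian metric $g(v,w)=\omega(v,Jw)$. Let $N$ be the Nijenhuis tensor of $J$, $$N(X,Y)=[JX,JY]-J[JX,Y]-J[X,JY]-[X,Y],$$ and let $\nabla$ be the Levi-Civita connection of $g$. Then the zero set of $N$ is equal to the zero set of $\nabla\omega$: for every $x\in M$, one has $N_x=0$ if and only if $(\nabla\omega)_x=0$. -/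

import Mathlib

open Bundle FiberBundle VectorField
open scoped Manifold ContDiff

set_option linter.unusedSectionVars false

noncomputable section

namespace AlmostKahler

variable {E : Type*} [NormedAddCommGroup E] [NormedSpace ℝ E]
  {H : Type*} [TopologicalSpace H] {I : ModelWithCorners ℝ E H}
  {M : Type*} [TopologicalSpace M] [ChartedSpace H M]

/-! ### Fields of bilinear forms -/

/-- A (not necessarily smooth) field of bilinear forms on the tangent spaces of `M`. -/
abbrev BilinField {E : Type*} [NormedAddCommGroup E] [NormedSpace ℝ E]
    {H : Type*} [TopologicalSpace H] (I : ModelWithCorners ℝ E H)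
    (M : Type*) [TopologicalSpace M] [ChartedSpace H M] :=
  Π x : M, TangentSpace I x →L[ℝ] TangentSpace I x →L[ℝ] ℝ

/-- Smoothness of a field of bilinear forms, as a section of the bundle `Hom(TM, Hom(TM, ℝ))`. -/
def BilinField.IsSmooth [IsManifold I ∞ M] (B : BilinField I M) : Prop :=
  ContMDiff I (I.prod 𝓘(ℝ, E →L[ℝ] E →L[ℝ] ℝ)) ∞
    (fun x ↦ TotalSpace.mk' (E →L[ℝ] E →L[ℝ] ℝ)
      (E := fun x : M ↦ TangentSpace I x →L[ℝ] TangentSpace I x →L[ℝ] ℝ) x (B x))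

theorem BilinField.IsSmooth.mdifferentiableAt [IsManifold I ∞ M] {B : BilinField I M}
    (hB : B.IsSmooth) {X Y : Π x : M, TangentSpace I x} {x : M}
    (hX : MDiffAt (T% X) x) (hY : MDiffAt (T% Y) x) :
    MDiffAt (fun y ↦ B y (X y) (Y y)) x := by
  have : MDifferentiableAt I (I.prod 𝓘(ℝ))
      (fun m ↦ TotalSpace.mk' ℝ (E := Bundle.Trivial M ℝ) m (B m (X m) (Y m))) x := by
    apply MDifferentiableAt.clm_bundle_apply₂ (F₁ := E) (F₂ := E)
      (E₁ := fun x : M ↦ TangentSpace I x) (E₂ := fun x : M ↦ TangentSpace I x)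
    · exact (ContMDiff.contMDiffAt hB).mdifferentiableAt (by simp)
    · exact hX
    · exact hY
  simp only [mdifferentiableAt_totalSpace] at this
  exact this.2

variable [FiniteDimensional ℝ E] [IsManifold I ∞ M]

/-! ### The Levi-Civita connection of a Riemannian metric -/

section LeviCivita

/-- A smooth Riemannian metric on `M`. -/
abbrev RiemMetric {E : Type*} [NormedAddCommGroup E] [NormedSpace ℝ E]
    {H : Type*} [TopologicalSpace H] (I : ModelWithCorners ℝ E H)
    (M : Type*) [TopologicalSpace M] [ChartedSpace H M] [IsManifold I ∞ M] :=
  ContMDiffRiemannianMetric I ∞ E (fun x : M ↦ TangentSpace I x)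

variable (g : RiemMetric I M)

theorem RiemMetric.isSmooth : BilinField.IsSmooth (I := I) (M := M) g.inner := g.contMDiff

/-- The right-hand side of the Koszul formula: the value of `2 g(∇_X Y, Z)` at `x`. -/
def koszul (X Y Z : Π x : M, TangentSpace I x) (x : M) : ℝ :=
  d% (fun y ↦ g.inner y (Y y) (Z y)) x (X x) + d% (fun y ↦ g.inner y (X y) (Z y)) x (Y x)
    - d% (fun y ↦ g.inner y (X y) (Y y)) x (Z x)
    + g.inner x (mlieBracket I X Y x) (Z x) - g.inner x (mlieBracket I X Z x) (Y x)
    - g.inner x (mlieBracket I Y Z x) (X x)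

theorem koszul_tensorial_left {Y Z : Π x : M, TangentSpace I x} {x : M}
    (hY : MDiffAt (T% Y) x) (hZ : MDiffAt (T% Z) x) :
    TensorialAt I E (fun X ↦ koszul g X Y Z x) x where
  smul {f X} hf hX := by
    have : CompleteSpace E := FiniteDimensional.complete ℝ E
    simp [koszul, mvfderiv_fun_mul hf (g.isSmooth.mdifferentiableAt hX hZ),
      mvfderiv_fun_mul hf (g.isSmooth.mdifferentiableAt hX hY), mlieBracket_smul_left hf hX]
    ring
  add {X X'} hX hX' := by
    have : CompleteSpace E := FiniteDimensional.complete ℝ E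
    simp [koszul, mvfderiv_fun_add (g.isSmooth.mdifferentiableAt hX hZ)
      (g.isSmooth.mdifferentiableAt hX' hZ), mvfderiv_fun_add (g.isSmooth.mdifferentiableAt hX hY)
      (g.isSmooth.mdifferentiableAt hX' hY), mlieBracket_add_left hX hX']
    ring

theorem koszul_tensorial_right {X Y : Π x : M, TangentSpace I x} {x : M}
    (hX : MDiffAt (T% X) x) (hY : MDiffAt (T% Y) x) :
    TensorialAt I E (fun Z ↦ koszul g X Y Z x) x where
  smul {f Z} hf hZ := by
    have : CompleteSpace E := FiniteDimensional.complete ℝ E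
    simp [koszul, mvfderiv_fun_mul hf (g.isSmooth.mdifferentiableAt hX hZ),
      mvfderiv_fun_mul hf (g.isSmooth.mdifferentiableAt hY hZ), mlieBracket_smul_right hf hZ]
    rw [g.symm x (Z x) (X x), g.symm x (Z x) (Y x)]
    ring
  add {Z Z'} hZ hZ' := by
    have : CompleteSpace E := FiniteDimensional.complete ℝ E
    simp [koszul, mvfderiv_fun_add (g.isSmooth.mdifferentiableAt hX hZ)
      (g.isSmooth.mdifferentiableAt hX hZ'), mvfderiv_fun_add (g.isSmooth.mdifferentiableAt hY hZ)
      (g.isSmooth.mdifferentiableAt hY hZ'), mlieBracket_add_right hZ hZ']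
    ring

/-- For a vector field `Y` differentiable at `x`, the bilinear form `(X, Z) ↦ 2 g(∇_X Y, Z)` on
the tangent space at `x`, given by the Koszul formula. -/
def koszulForm {Y : Π x : M, TangentSpace I x} {x : M} (hY : MDiffAt (T% Y) x) :
    TangentSpace I x →L[ℝ] TangentSpace I x →L[ℝ] ℝ :=
  TensorialAt.mkHom₂ (fun X Z ↦ koszul g X Y Z x) x
    (fun _ hZ ↦ koszul_tensorial_left g hY hZ) (fun _ hX ↦ koszul_tensorial_right g hX hY)

theorem koszulForm_apply {X Y Z : Π x : M, TangentSpace I x} {x : M}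
    (hX : MDiffAt (T% X) x) (hY : MDiffAt (T% Y) x) (hZ : MDiffAt (T% Z) x) :
    koszulForm g hY (X x) (Z x) = koszul g X Y Z x :=
  TensorialAt.mkHom₂_apply _ _ hX hZ

theorem exists_sharp (x : M) (B : TangentSpace I x →L[ℝ] TangentSpace I x →L[ℝ] ℝ) :
    ∃ A : TangentSpace I x →L[ℝ] TangentSpace I x, ∀ u v, g.inner x (A u) v = B u v := by
  have : FiniteDimensional ℝ (TangentSpace I x) := inferInstanceAs (FiniteDimensional ℝ E)
  have : T2Space (TangentSpace I x) := inferInstanceAs (T2Space E)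
  let f : TangentSpace I x →ₗ[ℝ] Module.Dual ℝ (TangentSpace I x) :=
    (ContinuousLinearMap.coeLM ℝ) ∘ₗ (g.inner x).toLinearMap
  have hf : Function.Injective f := by
    rw [injective_iff_map_eq_zero]
    intro v hv
    by_contra h
    have := g.pos x v h
    have h2 : f v v = 0 := by rw [hv]; rfl
    exact this.ne' h2
  let e := LinearEquiv.ofInjectiveOfFinrankEq f hf Subspace.dual_finrank_eq.symm
  refine ⟨LinearMap.toContinuousLinearMap
    (e.symm.toLinearMap ∘ₗ (ContinuousLinearMap.coeLM ℝ) ∘ₗ B.toLinearMap), fun u v ↦ ?_⟩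
  have := congr($(e.apply_symm_apply (ContinuousLinearMap.coeLM ℝ (B u))) v)
  exact this

/-- The endomorphism `A` with `g(A u, v) = B(u, v)`. -/
def sharp (x : M) (B : TangentSpace I x →L[ℝ] TangentSpace I x →L[ℝ] ℝ) :
    TangentSpace I x →L[ℝ] TangentSpace I x :=
  (exists_sharp g x B).choose

theorem inner_sharp (x : M) (B : TangentSpace I x →L[ℝ] TangentSpace I x →L[ℝ] ℝ)
    (u v : TangentSpace I x) : g.inner x (sharp g x B u) v = B u v :=
  (exists_sharp g x B).choose_spec u v

theorem RiemMetric.ext_left {x : M} {u v : TangentSpace I x}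
    (h : ∀ w, g.inner x u w = g.inner x v w) : u = v := by
  by_contra hne
  have := g.pos x (u - v) (sub_ne_zero.2 hne)
  have h2 : g.inner x (u - v) (u - v) = 0 := by
    have := h (u - v)
    rw [(g.inner x).map_sub, sub_apply, this, sub_self]
  exact this.ne' h2

open Classical in
/-- `∇ Y` for the Levi-Civita connection of `g`, determined by the Koszul formula at the points
where the vector field `Y` is differentiable (the value elsewhere is irrelevant). -/
def leviCivitaFun (Y : Π x : M, TangentSpace I x) (x : M) :
    TangentSpace I x →L[ℝ] TangentSpace I x :=
  if hY : MDiffAt (T% Y) x then sharp g x ((1 / 2 : ℝ) • koszulForm g hY) else 0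

theorem inner_leviCivitaFun {X Y Z : Π x : M, TangentSpace I x} {x : M}
    (hX : MDiffAt (T% X) x) (hY : MDiffAt (T% Y) x) (hZ : MDiffAt (T% Z) x) :
    g.inner x (leviCivitaFun g Y x (X x)) (Z x) = (1 / 2) * koszul g X Y Z x := by
  rw [leviCivitaFun, dif_pos hY, inner_sharp]
  simp [← koszulForm_apply g hX hY hZ]

theorem leviCivitaFun_ext {x : M} {A B : TangentSpace I x →L[ℝ] TangentSpace I x}
    (h : ∀ X Z : Π x : M, TangentSpace I x, MDiffAt (T% X) x → MDiffAt (T% Z) x →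
      g.inner x (A (X x)) (Z x) = g.inner x (B (X x)) (Z x)) : A = B := by
  ext u
  refine g.ext_left fun w ↦ ?_
  simpa using h (extend E u) (extend E w) (mdifferentiableAt_extend ..)
    (mdifferentiableAt_extend ..)

/-- The Levi-Civita connection of the Riemannian metric `g`. -/
def leviCivita : CovariantDerivative I E (fun x : M ↦ TangentSpace I x) where
  toFun := leviCivitaFun g
  isCovariantDerivativeOnUniv :=
    { add := by
        intro Y Y' x hY hY' _
        have : CompleteSpace E := FiniteDimensional.complete ℝ E
        refine leviCivitaFun_ext g fun X Z hX hZ ↦ ?_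
        rw [inner_leviCivitaFun g hX (mdifferentiableAt_add_section hY hY') hZ]
        simp only [add_apply, map_add]
        rw [inner_leviCivitaFun g hX hY hZ, inner_leviCivitaFun g hX hY' hZ]
        simp [koszul, mvfderiv_fun_add (g.isSmooth.mdifferentiableAt hY hZ)
          (g.isSmooth.mdifferentiableAt hY' hZ),
          mvfderiv_fun_add (g.isSmooth.mdifferentiableAt hX hY)
          (g.isSmooth.mdifferentiableAt hX hY'), mlieBracket_add_left hY hY',
          mlieBracket_add_right hY hY']
        ring
      leibniz := by
        intro Y f x hY hf _
        have : CompleteSpace E := FiniteDimensional.complete ℝ E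
        refine leviCivitaFun_ext g fun X Z hX hZ ↦ ?_
        rw [inner_leviCivitaFun g hX (hf.smul_section hY) hZ]
        simp only [add_apply, map_add, smul_apply,
          map_smul, ContinuousLinearMap.smulRight_apply]
        rw [inner_leviCivitaFun g hX hY hZ]
        simp [koszul, mvfderiv_fun_mul hf (g.isSmooth.mdifferentiableAt hY hZ),
          mvfderiv_fun_mul hf (g.isSmooth.mdifferentiableAt hX hY), mlieBracket_smul_left hf hY,
          mlieBracket_smul_right hf hY]
        rw [g.symm x (Y x) (X x)]
        ring }

/-- The Levi-Civita connection is compatible with the metric. -/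
theorem leviCivita_metric {X Y Z : Π x : M, TangentSpace I x} {x : M}
    (hX : MDiffAt (T% X) x) (hY : MDiffAt (T% Y) x) (hZ : MDiffAt (T% Z) x) :
    d% (fun y ↦ g.inner y (Y y) (Z y)) x (X x) =
      g.inner x (leviCivita g Y x (X x)) (Z x) + g.inner x (Y x) (leviCivita g Z x (X x)) := by
  rw [g.symm x (Y x)]
  change _ = g.inner x (leviCivitaFun g Y x (X x)) (Z x)
    + g.inner x (leviCivitaFun g Z x (X x)) (Y x)
  rw [inner_leviCivitaFun g hX hY hZ, inner_leviCivitaFun g hX hZ hY]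
  simp only [koszul, mlieBracket_swap_apply (V := Z) (W := Y), map_neg,
    neg_apply, g.symm _ (Z _) (Y _)]
  ring

/-- The Levi-Civita connection is torsion-free. -/
theorem leviCivita_torsion {X Y : Π x : M, TangentSpace I x} {x : M}
    (hX : MDiffAt (T% X) x) (hY : MDiffAt (T% Y) x) :
    leviCivita g Y x (X x) - leviCivita g X x (Y x) = mlieBracket I X Y x := by
  refine g.ext_left fun w ↦ ?_
  have hZ : MDiffAt (T% (extend E w : Π x : M, TangentSpace I x)) x := mdifferentiableAt_extend ..
  have h1 := inner_leviCivitaFun g hX hY hZ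
  have h2 := inner_leviCivitaFun g hY hX hZ
  have hw : (extend E w : Π x : M, TangentSpace I x) x = w := by simp
  rw [map_sub, sub_apply]
  change g.inner x (leviCivitaFun g Y x (X x)) w - g.inner x (leviCivitaFun g X x (Y x)) w = _
  rw [← hw, h1, h2]
  simp only [koszul, mlieBracket_swap_apply (V := Y) (W := X), map_neg,
    neg_apply, g.symm _ (Y _) (X _)]
  ring

end LeviCivita

/-! ### The covariant derivative and the exterior derivative of a 2-form -/

section TwoForms

/-- The expression `X (Ω(Y, Z)) - Ω(∇_X Y, Z) - Ω(Y, ∇_X Z)` at `x`, as a linear form in `X`. -/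
def covDerivAux (cov : CovariantDerivative I E (fun x : M ↦ TangentSpace I x))
    (Ω : BilinField I M) (Y Z : Π x : M, TangentSpace I x) (x : M) :
    TangentSpace I x →L[ℝ] ℝ :=
  have : FiniteDimensional ℝ (TangentSpace I x) := inferInstanceAs (FiniteDimensional ℝ E)
  have : T2Space (TangentSpace I x) := inferInstanceAs (T2Space E)
  LinearMap.toContinuousLinearMap
    { toFun u := d% (fun y ↦ Ω y (Y y) (Z y)) x u - Ω x (cov Y x u) (Z x) - Ω x (Y x) (cov Z x u)
      map_add' u v := by simp; ring
      map_smul' c u := by simp; ring }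

theorem covDerivAux_tensorial_left (cov : CovariantDerivative I E (fun x : M ↦ TangentSpace I x))
    {Ω : BilinField I M} (hΩ : Ω.IsSmooth) {Z : Π x : M, TangentSpace I x} {x : M}
    (hZ : MDiffAt (T% Z) x) : TensorialAt I E (fun Y ↦ covDerivAux cov Ω Y Z x) x where
  smul {f Y} hf hY := by
    ext u
    simp [covDerivAux, mvfderiv_fun_mul hf (hΩ.mdifferentiableAt hY hZ),
      cov.isCovariantDerivativeOn.leibniz hY hf]
    ring
  add {Y Y'} hY hY' := by
    ext u
    simp [covDerivAux, mvfderiv_fun_add (hΩ.mdifferentiableAt hY hZ)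
      (hΩ.mdifferentiableAt hY' hZ), cov.isCovariantDerivativeOn.add hY hY']
    ring

theorem covDerivAux_tensorial_right (cov : CovariantDerivative I E (fun x : M ↦ TangentSpace I x))
    {Ω : BilinField I M} (hΩ : Ω.IsSmooth) {Y : Π x : M, TangentSpace I x} {x : M}
    (hY : MDiffAt (T% Y) x) : TensorialAt I E (fun Z ↦ covDerivAux cov Ω Y Z x) x where
  smul {f Z} hf hZ := by
    ext u
    simp [covDerivAux, mvfderiv_fun_mul hf (hΩ.mdifferentiableAt hY hZ),
      cov.isCovariantDerivativeOn.leibniz hZ hf]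
    ring
  add {Z Z'} hZ hZ' := by
    ext u
    simp [covDerivAux, mvfderiv_fun_add (hΩ.mdifferentiableAt hY hZ)
      (hΩ.mdifferentiableAt hY hZ'), cov.isCovariantDerivativeOn.add hZ hZ']
    ring

/-- The covariant derivative `∇Ω` of a smooth field of bilinear forms, as a tensor:
`covDeriv cov hΩ x (Y x) (Z x) (X x)` is the value at `x` of
`(∇_X Ω)(Y, Z) = X (Ω(Y, Z)) - Ω(∇_X Y, Z) - Ω(Y, ∇_X Z)`. -/
def covDeriv (cov : CovariantDerivative I E (fun x : M ↦ TangentSpace I x))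
    {Ω : BilinField I M} (hΩ : Ω.IsSmooth) (x : M) :
    TangentSpace I x →L[ℝ] TangentSpace I x →L[ℝ] TangentSpace I x →L[ℝ] ℝ :=
  TensorialAt.mkHom₂ (fun Y Z ↦ covDerivAux cov Ω Y Z x) x
    (fun _ hZ ↦ covDerivAux_tensorial_left cov hΩ hZ)
    (fun _ hY ↦ covDerivAux_tensorial_right cov hΩ hY)

theorem covDeriv_apply (cov : CovariantDerivative I E (fun x : M ↦ TangentSpace I x))
    {Ω : BilinField I M} (hΩ : Ω.IsSmooth) {X Y Z : Π x : M, TangentSpace I x} {x : M}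
    (hY : MDiffAt (T% Y) x) (hZ : MDiffAt (T% Z) x) :
    covDeriv cov hΩ x (Y x) (Z x) (X x) = d% (fun y ↦ Ω y (Y y) (Z y)) x (X x)
      - Ω x (cov Y x (X x)) (Z x) - Ω x (Y x) (cov Z x (X x)) := by
  rw [covDeriv, TensorialAt.mkHom₂_apply _ _ hY hZ]
  simp [covDerivAux]

/-- The value `dΩ(X, Y, Z)` at `x` of the exterior derivative of a 2-form, on three vector fields
(Cartan's formula). -/
def extDerivTwo (Ω : BilinField I M) (X Y Z : Π x : M, TangentSpace I x) (x : M) : ℝ :=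
  d% (fun y ↦ Ω y (Y y) (Z y)) x (X x) - d% (fun y ↦ Ω y (X y) (Z y)) x (Y x)
    + d% (fun y ↦ Ω y (X y) (Y y)) x (Z x)
    - Ω x (mlieBracket I X Y x) (Z x) + Ω x (mlieBracket I X Z x) (Y x)
    - Ω x (mlieBracket I Y Z x) (X x)

end TwoForms

/-! ### Almost-complex structures and the Nijenhuis tensor -/

/-- A smooth almost-complex structure on `M`: a smooth section `J` of `Hom(TM, TM)` such that
`J² = -1`. -/
structure AlmostComplexStructure {E : Type*} [NormedAddCommGroup E] [NormedSpace ℝ E]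
    {H : Type*} [TopologicalSpace H] (I : ModelWithCorners ℝ E H)
    (M : Type*) [TopologicalSpace M] [ChartedSpace H M] [IsManifold I ∞ M] where
  /-- the endomorphism of each tangent space -/
  toFun : Π x : M, TangentSpace I x →L[ℝ] TangentSpace I x
  smooth : ContMDiff I (I.prod 𝓘(ℝ, E →L[ℝ] E)) ∞
    (fun x ↦ TotalSpace.mk' (E →L[ℝ] E)
      (E := fun x : M ↦ TangentSpace I x →L[ℝ] TangentSpace I x) x (toFun x))
  sq_eq_neg : ∀ (x : M) (v : TangentSpace I x), toFun x (toFun x v) = -v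

namespace AlmostComplexStructure

variable (J : AlmostComplexStructure I M)

/-- The vector field `JX`. -/
def field (X : Π x : M, TangentSpace I x) : Π x : M, TangentSpace I x := fun x ↦ J.toFun x (X x)

theorem mdifferentiableAt_field {X : Π x : M, TangentSpace I x} {x : M}
    (hX : MDiffAt (T% X) x) : MDiffAt (T% (J.field X)) x :=
  MDifferentiableAt.clm_bundle_apply (F₁ := E) (F₂ := E)
    (E₁ := fun x : M ↦ TangentSpace I x) (E₂ := fun x : M ↦ TangentSpace I x)
    ((ContMDiff.contMDiffAt J.smooth).mdifferentiableAt (by simp)) hX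

theorem field_add (X Y : Π x : M, TangentSpace I x) :
    J.field (X + Y) = J.field X + J.field Y := by
  ext x; simp [field]

theorem field_smul (f : M → ℝ) (X : Π x : M, TangentSpace I x) :
    J.field (f • X) = f • J.field X := by
  ext x; simp [field]

/-- The expression `[JX, JY] - J[JX, Y] - J[X, JY] - [X, Y]` at `x`. -/
def nijenhuisAux (X Y : Π x : M, TangentSpace I x) (x : M) : TangentSpace I x :=
  mlieBracket I (J.field X) (J.field Y) x - J.toFun x (mlieBracket I (J.field X) Y x)
    - J.toFun x (mlieBracket I X (J.field Y) x) - mlieBracket I X Y x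

theorem nijenhuisAux_swap (X Y : Π x : M, TangentSpace I x) (x : M) :
    J.nijenhuisAux X Y x = - J.nijenhuisAux Y X x := by
  simp only [nijenhuisAux, mlieBracket_swap_apply (V := Y), map_neg,
    mlieBracket_swap_apply (V := J.field Y)]
  abel

theorem nijenhuisAux_tensorial_left (Y : Π x : M, TangentSpace I x) (x : M) :
    TensorialAt I E (fun X ↦ J.nijenhuisAux X Y x) x where
  smul {f X} hf hX := by
    have : CompleteSpace E := FiniteDimensional.complete ℝ E
    simp only [nijenhuisAux, field_smul, mlieBracket_smul_left hf hX,
      mlieBracket_smul_left hf (J.mdifferentiableAt_field hX), map_add, map_smul]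
    simp only [field, J.sq_eq_neg]
    module
  add {X X'} hX hX' := by
    have : CompleteSpace E := FiniteDimensional.complete ℝ E
    simp only [nijenhuisAux, field_add, mlieBracket_add_left hX hX',
      mlieBracket_add_left (J.mdifferentiableAt_field hX) (J.mdifferentiableAt_field hX'), map_add]
    abel

theorem nijenhuisAux_tensorial_right (X : Π x : M, TangentSpace I x) (x : M) :
    TensorialAt I E (fun Y ↦ J.nijenhuisAux X Y x) x where
  smul {f Y} hf hY := by
    rw [nijenhuisAux_swap, (J.nijenhuisAux_tensorial_left X x).smul hf hY, nijenhuisAux_swap J X]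
    module
  add {Y Y'} hY hY' := by
    rw [nijenhuisAux_swap, (J.nijenhuisAux_tensorial_left X x).add hY hY', nijenhuisAux_swap J X,
      nijenhuisAux_swap J X]
    abel

/-- The Nijenhuis tensor `N(X, Y) = [JX, JY] - J[JX, Y] - J[X, JY] - [X, Y]` of `J`. -/
def nijenhuis (x : M) : TangentSpace I x →L[ℝ] TangentSpace I x →L[ℝ] TangentSpace I x :=
  TensorialAt.mkHom₂ (fun X Y ↦ J.nijenhuisAux X Y x) x
    (fun Y _ ↦ J.nijenhuisAux_tensorial_left Y x) (fun X _ ↦ J.nijenhuisAux_tensorial_right X x)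

theorem nijenhuis_apply {X Y : Π x : M, TangentSpace I x} {x : M}
    (hX : MDiffAt (T% X) x) (hY : MDiffAt (T% Y) x) :
    J.nijenhuis x (X x) (Y x) = mlieBracket I (J.field X) (J.field Y) x
      - J.toFun x (mlieBracket I (J.field X) Y x)
      - J.toFun x (mlieBracket I X (J.field Y) x) - mlieBracket I X Y x :=
  TensorialAt.mkHom₂_apply _ _ hX hY

end AlmostComplexStructure

/-! ### Almost-Kähler structures -/

/-- A symplectic form on `M`: a smooth 2-form that is closed and nondegenerate. -/
structure SymplecticForm {E : Type*} [NormedAddCommGroup E] [NormedSpace ℝ E]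
    {H : Type*} [TopologicalSpace H] (I : ModelWithCorners ℝ E H)
    (M : Type*) [TopologicalSpace M] [ChartedSpace H M] [IsManifold I ∞ M] where
  /-- the bilinear form on each tangent space -/
  toFun : BilinField I M
  smooth : toFun.IsSmooth
  alternating : ∀ (x : M) (v : TangentSpace I x), toFun x v v = 0
  nondegenerate : ∀ (x : M) (v : TangentSpace I x), v ≠ 0 → ∃ w, toFun x v w ≠ 0
  /-- `dΩ = 0`. The vector fields only have to be differentiable at the point considered; `dΩ`
  depends only on their values there. -/
  closed : ∀ (x : M) (X Y Z : Π x : M, TangentSpace I x),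
    MDiffAt (T% X) x → MDiffAt (T% Y) x → MDiffAt (T% Z) x → extDerivTwo toFun X Y Z x = 0

/-- An almost-Kähler structure `(g, J, Ω)` on `M`: a symplectic form `Ω`, an almost-complex
structure `J` compatible with `Ω`, and the associated Riemannian metric `g = Ω(·, J ·)`. -/
structure AlmostKahlerStructure {E : Type*} [NormedAddCommGroup E] [NormedSpace ℝ E]
    {H : Type*} [TopologicalSpace H] (I : ModelWithCorners ℝ E H)
    (M : Type*) [TopologicalSpace M] [ChartedSpace H M] [IsManifold I ∞ M] where
  /-- the Riemannian metric -/
  g : RiemMetric I M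
  /-- the almost-complex structure -/
  J : AlmostComplexStructure I M
  /-- the symplectic form -/
  Ω : SymplecticForm I M
  invariant : ∀ (x : M) (v w : TangentSpace I x),
    Ω.toFun x (J.toFun x v) (J.toFun x w) = Ω.toFun x v w
  tame : ∀ (x : M) (v : TangentSpace I x), v ≠ 0 → 0 < Ω.toFun x v (J.toFun x v)
  metric_eq : ∀ (x : M) (v w : TangentSpace I x), g.inner x v w = Ω.toFun x v (J.toFun x w)

/-- The tensor `∇Ω`, where `∇` is the Levi-Civita connection of `g`. -/
def AlmostKahlerStructure.nablaOmega (S : AlmostKahlerStructure I M) (x : M) :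
    TangentSpace I x →L[ℝ] TangentSpace I x →L[ℝ] TangentSpace I x →L[ℝ] ℝ :=
  covDeriv (leviCivita S.g) S.Ω.smooth x

end AlmostKahler

end

noncomputable section

namespace AlmostKahler

variable {E : Type*} [NormedAddCommGroup E] [NormedSpace ℝ E] [FiniteDimensional ℝ E]
  {H : Type*} [TopologicalSpace H] {I : ModelWithCorners ℝ E H}
  {M : Type*} [TopologicalSpace M] [ChartedSpace H M] [IsManifold I ∞ M]

theorem exists_mdifferentiableAt_eq (x : M) (u : TangentSpace I x) :
    ∃ X : Π y : M, TangentSpace I y, MDiffAt (T% X) x ∧ X x = u :=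
  ⟨extend E u, mdifferentiableAt_extend .., by simp⟩

namespace SymplecticForm

theorem antisymm (Ω : SymplecticForm I M) (x : M) (v w : TangentSpace I x) :
    Ω.toFun x v w = -Ω.toFun x w v := by
  have h := Ω.alternating x (v + w)
  simp only [map_add, add_apply, Ω.alternating x v, Ω.alternating x w] at h
  linarith

theorem covDeriv_antisymm (Ω : SymplecticForm I M)
    (cov : CovariantDerivative I E (fun x : M ↦ TangentSpace I x)) (x : M)
    (u v w : TangentSpace I x) :
    covDeriv cov Ω.smooth x u v w = -covDeriv cov Ω.smooth x v u w := by
  obtain ⟨X, hX, rfl⟩ := exists_mdifferentiableAt_eq x u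
  obtain ⟨Y, hY, rfl⟩ := exists_mdifferentiableAt_eq x v
  obtain ⟨Z, hZ, rfl⟩ := exists_mdifferentiableAt_eq x w
  have hfun : (fun y ↦ Ω.toFun y (X y) (Y y)) = fun y ↦ -Ω.toFun y (Y y) (X y) :=
    funext fun y ↦ Ω.antisymm y _ _
  rw [covDeriv_apply cov Ω.smooth hX hY, covDeriv_apply cov Ω.smooth hY hX, hfun, mvfderiv_fun_neg,
    Ω.antisymm x _ (Y x), Ω.antisymm x (X x)]
  simp only [neg_apply]
  ring

theorem covDeriv_leviCivita_cyclic (Ω : SymplecticForm I M) (g : RiemMetric I M) (x : M)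
    (u v w : TangentSpace I x) :
    covDeriv (leviCivita g) Ω.smooth x v w u + covDeriv (leviCivita g) Ω.smooth x w u v
      + covDeriv (leviCivita g) Ω.smooth x u v w = 0 := by
  rw [Ω.covDeriv_antisymm _ x w u v]
  obtain ⟨X, hX, rfl⟩ := exists_mdifferentiableAt_eq x u
  obtain ⟨Y, hY, rfl⟩ := exists_mdifferentiableAt_eq x v
  obtain ⟨Z, hZ, rfl⟩ := exists_mdifferentiableAt_eq x w
  have h := Ω.closed x X Y Z hX hY hZ
  rw [extDerivTwo, ← leviCivita_torsion g hX hY, ← leviCivita_torsion g hX hZ,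
    ← leviCivita_torsion g hY hZ] at h
  simp only [map_sub, sub_apply] at h
  rw [covDeriv_apply _ Ω.smooth hY hZ, covDeriv_apply _ Ω.smooth hX hZ,
    covDeriv_apply _ Ω.smooth hX hY, Ω.antisymm x (Y x) (leviCivita g Z x (X x)),
    Ω.antisymm x (X x) (leviCivita g Z x (Y x)), Ω.antisymm x (X x) (leviCivita g Y x (Z x))]
  linarith

end SymplecticForm

namespace AlmostKahlerStructure

variable (S : AlmostKahlerStructure I M)

theorem omega_eq_inner (x : M) (v w : TangentSpace I x) :
    S.Ω.toFun x v w = S.g.inner x (S.J.toFun x v) w := by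
  rw [S.metric_eq, S.invariant]

theorem inner_J_left (x : M) (v w : TangentSpace I x) :
    S.g.inner x (S.J.toFun x v) w = -S.g.inner x v (S.J.toFun x w) := by
  rw [← S.omega_eq_inner, S.metric_eq, S.J.sq_eq_neg, map_neg, neg_neg]

/-- `(∇_X Ω)(Y, Z) = g((∇_X J) Y, Z)`. -/
theorem nablaOmega_eq_inner {X Y : Π x : M, TangentSpace I x} {x : M}
    (hY : MDiffAt (T% Y) x) (w : TangentSpace I x) :
    S.nablaOmega x (Y x) w (X x) =
      S.g.inner x (leviCivita S.g (S.J.field Y) x (X x)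
        - S.J.toFun x (leviCivita S.g Y x (X x))) w := by
  obtain ⟨Z, hZ, rfl⟩ := exists_mdifferentiableAt_eq x w
  obtain ⟨X', hX', hX⟩ := exists_mdifferentiableAt_eq x (X x)
  have hfun : (fun y ↦ S.Ω.toFun y (Y y) (Z y)) = fun y ↦ S.g.inner y (S.J.field Y y) (Z y) :=
    funext fun y ↦ S.omega_eq_inner y _ _
  rw [← hX, nablaOmega, covDeriv_apply _ S.Ω.smooth hY hZ, hfun,
    leviCivita_metric S.g hX' (S.J.mdifferentiableAt_field hY) hZ, S.omega_eq_inner,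
    S.omega_eq_inner, map_sub, sub_apply]
  simp only [AlmostComplexStructure.field]
  ring

theorem nablaOmega_J (x : M) (u v w : TangentSpace I x) :
    S.nablaOmega x (S.J.toFun x u) v w = S.nablaOmega x u (S.J.toFun x v) w := by
  obtain ⟨Y, hY, rfl⟩ := exists_mdifferentiableAt_eq x u
  obtain ⟨X, hX, rfl⟩ := exists_mdifferentiableAt_eq x w
  have hJJ : S.J.field (S.J.field Y) = (-1 : ℝ) • Y := by
    ext y
    simp [AlmostComplexStructure.field, S.J.sq_eq_neg]
  have hneg : leviCivita S.g ((-1 : ℝ) • Y) x (X x) = -leviCivita S.g Y x (X x) := by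
    rw [(leviCivita S.g).isCovariantDerivativeOn.smul_const (-1) hY]
    simp
  have h := S.nablaOmega_eq_inner (X := X) (S.J.mdifferentiableAt_field hY) v
  rw [hJJ, hneg] at h
  refine h.trans ?_
  rw [S.nablaOmega_eq_inner hY]
  simp only [map_sub, sub_apply, map_neg, neg_apply]
  rw [S.inner_J_left, ← neg_eq_iff_eq_neg.2 (S.inner_J_left x (S.J.toFun x _) v), S.J.sq_eq_neg]
  simp only [map_neg, neg_apply]
  ring

theorem nablaOmega_antisymm (x : M) (u v w : TangentSpace I x) :
    S.nablaOmega x u v w = -S.nablaOmega x v u w :=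
  S.Ω.covDeriv_antisymm _ x u v w

theorem nablaOmega_cyclic (x : M) (u v w : TangentSpace I x) :
    S.nablaOmega x v w u + S.nablaOmega x w u v + S.nablaOmega x u v w = 0 :=
  S.Ω.covDeriv_leviCivita_cyclic S.g x u v w

theorem inner_nijenhuis_eq_sum (x : M) (u v w : TangentSpace I x) :
    S.g.inner x (S.J.nijenhuis x u v) w =
      S.nablaOmega x v w (S.J.toFun x u) - S.nablaOmega x u w (S.J.toFun x v)
        - S.nablaOmega x u (S.J.toFun x w) v + S.nablaOmega x v (S.J.toFun x w) u := by
  obtain ⟨X, hX, rfl⟩ := exists_mdifferentiableAt_eq x u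
  obtain ⟨Y, hY, rfl⟩ := exists_mdifferentiableAt_eq x v
  have hJX := S.J.mdifferentiableAt_field hX
  have hJY := S.J.mdifferentiableAt_field hY
  have h1 := S.nablaOmega_eq_inner (X := S.J.field X) hY w
  have h2 := S.nablaOmega_eq_inner (X := S.J.field Y) hX w
  rw [S.nablaOmega_eq_inner (X := Y) hX, S.nablaOmega_eq_inner (X := X) hY,
    show S.J.toFun x (X x) = S.J.field X x from rfl,
    show S.J.toFun x (Y x) = S.J.field Y x from rfl, h1, h2,
    S.J.nijenhuis_apply hX hY, ← leviCivita_torsion S.g hJX hJY, ← leviCivita_torsion S.g hJX hY,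
    ← leviCivita_torsion S.g hX hJY, ← leviCivita_torsion S.g hX hY]
  simp only [map_sub, sub_apply, S.inner_J_left, S.J.sq_eq_neg, map_neg]
  ring

/-- `g(N(u, v), w) = -2 (∇_w Ω)(J u, v)`. -/
theorem inner_nijenhuis (x : M) (u v w : TangentSpace I x) :
    S.g.inner x (S.J.nijenhuis x u v) w = -2 * S.nablaOmega x (S.J.toFun x u) v w := by
  rw [inner_nijenhuis_eq_sum]
  have c1 := S.nablaOmega_cyclic x (S.J.toFun x u) v w
  have c2 := S.nablaOmega_cyclic x (S.J.toFun x v) u w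
  have a1 := S.nablaOmega_antisymm x u w (S.J.toFun x v)
  have a2 := S.nablaOmega_antisymm x (S.J.toFun x w) u v
  have a3 := S.nablaOmega_antisymm x (S.J.toFun x w) v u
  have a4 := S.nablaOmega_antisymm x v (S.J.toFun x u) w
  have j1 := S.nablaOmega_J x w u v
  have j2 := S.nablaOmega_J x w v u
  have j3 := S.nablaOmega_J x v u w
  linarith

theorem nijenhuis_eq_zero_iff (x : M) : S.J.nijenhuis x = 0 ↔ S.nablaOmega x = 0 := by
  constructor
  · intro h
    refine DFunLike.ext _ _ fun u ↦ DFunLike.ext _ _ fun v ↦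
      DFunLike.ext _ _ fun w ↦ ?_
    have h1 := S.inner_nijenhuis x u (S.J.toFun x v) w
    rw [h, S.nablaOmega_J, S.J.sq_eq_neg, map_neg, neg_apply, zero_apply, zero_apply, map_zero,
      zero_apply] at h1
    change S.nablaOmega x u v w = 0
    linarith
  · intro h
    refine DFunLike.ext _ _ fun u ↦ DFunLike.ext _ _ fun v ↦ ?_
    refine S.g.ext_left fun w ↦ ?_
    rw [S.inner_nijenhuis, h]
    simp

end AlmostKahlerStructure

end AlmostKahler

end

theorem proposition1 {E : Type*} [NormedAddCommGroup E] [NormedSpace ℝ E] [FiniteDimensional ℝ E]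
    {H : Type*} [TopologicalSpace H] {I : ModelWithCorners ℝ E H}
    {M : Type*} [TopologicalSpace M] [ChartedSpace H M] [IsManifold I ∞ M]
    (S : AlmostKahler.AlmostKahlerStructure I M) :
    {x : M | S.J.nijenhuis x = 0} = {x : M | S.nablaOmega x = 0} :=
  Set.ext S.nijenhuis_eq_zero_iff
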